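/- A unit square layout is a finite family $(R_i)_{i\in I}$ of pairwise disjoint closed axis-parallel unit squares in the plane $\mathbb{R}^2$. For distinct $i, j \in I$, the squares $R_i$ and $R_j$ see each other if there is a closed axis-parallel rectangle $S$ of positive width and positive height such that one side of $S$ (left, right, upper or lower) is contained in $R_i$, the opposite side of $S$ is contained in $R_j$, and $S \cap R_k = \emptyset$ for every $k \in I \setminus \{i, j\}$. A finite simple graph $G = (V, E)$ is a unit square visibility graph if there is a unit square layout $(R_v)_{v \in V}$ such that, for all distinct $u, v \in V$, $\{u, v\} \in E$ if and only if $R_u$ and $R_v$ see each other. **Theorem.** Let $T$ be a finite tree with maximum degree $k$. If $k \leq 5$, then $T$ is a unit square visibility graph. If $k \geq 7$, then $T$ is not a unit square visibility graph. -/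

import Mathlib

/-- The closed axis-parallel unit square whose position (lower left corner) is `p`. -/
def unitSquare (p : ℝ × ℝ) : Set (ℝ × ℝ) :=
  Set.Icc p.1 (p.1 + 1) ×ˢ Set.Icc p.2 (p.2 + 1)

/-- In the family `R` of subsets of the plane, `R i` sees `R j` from the left: there is a closed
non-degenerate axis-parallel rectangle `[a, b] × [c, d]` whose left side lies in `R i`, whose right
side lies in `R j`, and which meets no other member of the family. -/
def SeesFromLeft {ι : Type*} (R : ι → Set (ℝ × ℝ)) (i j : ι) : Prop :=
  ∃ a b c d : ℝ, a < b ∧ c < d ∧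
    {a} ×ˢ Set.Icc c d ⊆ R i ∧ {b} ×ˢ Set.Icc c d ⊆ R j ∧
    ∀ k, k ≠ i → k ≠ j → Disjoint (Set.Icc a b ×ˢ Set.Icc c d) (R k)

/-- In the family `R`, `R i` sees `R j` from above: there is a closed non-degenerate axis-parallel
rectangle `[a, b] × [c, d]` whose upper side lies in `R i`, whose lower side lies in `R j`, and
which meets no other member of the family. -/
def SeesFromAbove {ι : Type*} (R : ι → Set (ℝ × ℝ)) (i j : ι) : Prop :=
  ∃ a b c d : ℝ, a < b ∧ c < d ∧
    Set.Icc a b ×ˢ {d} ⊆ R i ∧ Set.Icc a b ×ˢ {c} ⊆ R j ∧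
    ∀ k, k ≠ i → k ≠ j → Disjoint (Set.Icc a b ×ˢ Set.Icc c d) (R k)

/-- A unit square layout: pairwise disjoint closed unit squares in the plane, indexed by `ι`. -/
structure UnitSquareLayout (ι : Type*) where
  /-- the position (lower left corner) of each square -/
  pos : ι → ℝ × ℝ
  disjoint : ∀ i j, i ≠ j → Disjoint (unitSquare (pos i)) (unitSquare (pos j))

/-- The square with index `i`. -/
def UnitSquareLayout.square {ι : Type*} (L : UnitSquareLayout ι) (i : ι) : Set (ℝ × ℝ) :=
  unitSquare (L.pos i)

/-- The graph represented by a unit square layout: two distinct indices are adjacent if and only if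
one of their squares sees the other horizontally or vertically. -/
def UnitSquareLayout.graph {ι : Type*} (L : UnitSquareLayout ι) : SimpleGraph ι where
  Adj i j := i ≠ j ∧
    ((SeesFromLeft L.square i j ∨ SeesFromLeft L.square j i) ∨
      (SeesFromAbove L.square i j ∨ SeesFromAbove L.square j i))
  symm := ⟨fun _ _ h => ⟨h.1.symm, h.2.imp Or.symm Or.symm⟩⟩
  loopless := ⟨fun _ h => h.1 rfl⟩

/-- A unit square visibility graph: a finite graph `G` represented by some unit square layout, the
square for the vertex `v` being the one with index `v`. -/
def IsUnitSquareVisibilityGraph {V : Type*} (G : SimpleGraph V) : Prop :=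
  Finite V ∧ ∃ L : UnitSquareLayout V, L.graph = G

/-!
The graph of a layout is studied through its horizontal part; reflecting the plane in the diagonal
(`UnitSquareLayout.swap`) exchanges horizontal and vertical visibility.

*Vertices of large degree.* Two squares crossed by a common horizontal strip are joined by a walk
through squares that the strip meets between them (`UnitSquareLayout.exists_walk_in_strip`). In an
acyclic graph, such a walk between two neighbours of `v` passes through `v`. So among the squares in
horizontal view of `v` at most one is higher than `v`, at most one is lower, and one that is level
with `v` is alone on its side of `v`. This leaves at most three horizontal neighbours
(`UnitSquareLayout.card_filter_seesHorizontally_le`), likewise at most three vertical ones, and the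
degree is at most six.

*Trees of maximum degree at most five.* The tree is built from spiders. A horizontal spider has a
centre and three legs, one level with the centre running to the left and two at heights `± 1 / 2`
running to the right. Each leg is a row of squares at one height, so only consecutive ones see each
other. The centre hides the first leg from the other two, and these are at heights differing by one
and do not see each other. Vertical spiders are the reflections of horizontal ones. The tree is
rooted at a leaf or at its only vertex, so that every vertex has at most four children. If a vertex
lies on a leg of one orientation, then one child continues that leg and the other three start the
legs of a spider of the other orientation centred at the vertex. Each vertex other than the root
thus lies on exactly one leg. If the coordinates along the legs are `± 4` times the position in an
enumeration in which parents come first, different spiders of the same orientation occupy disjoint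
ranges, and each leg runs outwards. Visibility between the vertices is then exactly the
parent-child relation (`IsSpiderFamily.seesHorizontally_par`,
`IsSpiderFamily.par_eq_of_seesHorizontally`, `LabelledRootedTree.isSpiderFamily`).
-/

/-! ### Visibility between unit squares -/

theorem disjoint_Icc_iff_lt_or_lt {a b c d : ℝ} (hab : a ≤ b) (hcd : c ≤ d) :
    Disjoint (Set.Icc a b) (Set.Icc c d) ↔ b < c ∨ d < a := by
  rw [Set.disjoint_iff_inter_eq_empty, Set.Icc_inter_Icc, Set.Icc_eq_empty_iff, not_le]
  grind

theorem disjoint_unitSquare_iff {p q : ℝ × ℝ} :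
    Disjoint (unitSquare p) (unitSquare q) ↔ 1 < |p.1 - q.1| ∨ 1 < |p.2 - q.2| := by
  unfold unitSquare
  rw [Set.disjoint_prod, disjoint_Icc_iff_lt_or_lt (by linarith) (by linarith),
    disjoint_Icc_iff_lt_or_lt (by linarith) (by linarith)]
  grind

theorem disjoint_rectangle_unitSquare_iff {a b c d : ℝ} (hab : a ≤ b) (hcd : c ≤ d) {p : ℝ × ℝ} :
    Disjoint (Set.Icc a b ×ˢ Set.Icc c d) (unitSquare p) ↔
      (b < p.1 ∨ p.1 + 1 < a) ∨ (d < p.2 ∨ p.2 + 1 < c) := by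
  unfold unitSquare
  rw [Set.disjoint_prod, disjoint_Icc_iff_lt_or_lt hab (by linarith),
    disjoint_Icc_iff_lt_or_lt hcd (by linarith)]

theorem singleton_prod_Icc_subset_unitSquare_iff {a c d : ℝ} (hcd : c ≤ d) {p : ℝ × ℝ} :
    {a} ×ˢ Set.Icc c d ⊆ unitSquare p ↔
      (p.1 ≤ a ∧ a ≤ p.1 + 1) ∧ (p.2 ≤ c ∧ d ≤ p.2 + 1) := by
  unfold unitSquare
  rw [Set.prod_subset_prod_iff, Set.singleton_subset_iff, Set.Icc_subset_Icc_iff hcd, Set.mem_Icc,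
    or_iff_left (by simp [Set.Icc_eq_empty_iff, hcd])]

/-- Visibility from the left is transported to visibility from above by reflecting the plane in the
diagonal. -/
theorem seesFromAbove_iff_seesFromLeft_swap {ι : Type*} (p : ι → ℝ × ℝ) (i j : ι) :
    SeesFromAbove (fun k => unitSquare (p k)) i j ↔
      SeesFromLeft (fun k => unitSquare (p k).swap) j i := by
  have hsub (s t : Set ℝ) (k : ι) :
      s ×ˢ t ⊆ unitSquare (p k) ↔ t ×ˢ s ⊆ unitSquare (p k).swap := by
    simp only [Set.subset_def, unitSquare, Set.mem_prod, Prod.forall, Prod.fst_swap, Prod.snd_swap]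
    grind
  have hdis (s t : Set ℝ) (k : ι) :
      Disjoint (s ×ˢ t) (unitSquare (p k)) ↔ Disjoint (t ×ˢ s) (unitSquare (p k).swap) := by
    simp only [unitSquare, Set.disjoint_prod, Prod.fst_swap, Prod.snd_swap]
    exact or_comm
  simp only [SeesFromAbove, SeesFromLeft, hsub, hdis]
  constructor
  · rintro ⟨a, b, c, d, hab, hcd, hi, hj, h⟩
    exact ⟨c, d, a, b, hcd, hab, hj, hi, fun k h₁ h₂ => h k h₂ h₁⟩
  · rintro ⟨c, d, a, b, hcd, hab, hj, hi, h⟩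
    exact ⟨a, b, c, d, hab, hcd, hi, hj, fun k h₁ h₂ => h k h₂ h₁⟩

namespace UnitSquareLayout

variable {ι : Type*} (L : UnitSquareLayout ι)

theorem one_lt_abs_sub {i j : ι} (hij : i ≠ j) :
    1 < |(L.pos i).1 - (L.pos j).1| ∨ 1 < |(L.pos i).2 - (L.pos j).2| :=
  disjoint_unitSquare_iff.1 (L.disjoint i j hij)

/-- A horizontal strip running from one square to another, and missed by all squares lying between
the two, makes the first see the second. -/
theorem seesFromLeft_of_strip {i j : ι} {c d : ℝ} (hx : (L.pos i).1 + 1 < (L.pos j).1) (hcd : c < d)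
    (hi : (L.pos i).2 ≤ c ∧ d ≤ (L.pos i).2 + 1) (hj : (L.pos j).2 ≤ c ∧ d ≤ (L.pos j).2 + 1)
    (h : ∀ k, (L.pos i).1 < (L.pos k).1 → (L.pos k).1 < (L.pos j).1 →
      d < (L.pos k).2 ∨ (L.pos k).2 + 1 < c) : SeesFromLeft L.square i j := by
  refine ⟨(L.pos i).1 + 1, (L.pos j).1, c, d, hx, hcd,
    (singleton_prod_Icc_subset_unitSquare_iff hcd.le).2 ⟨by constructor <;> linarith, hi⟩,
    (singleton_prod_Icc_subset_unitSquare_iff hcd.le).2 ⟨by constructor <;> linarith, hj⟩,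
    fun k hki hkj => (disjoint_rectangle_unitSquare_iff hx.le hcd.le).2 ?_⟩
  have h₁ := L.one_lt_abs_sub hki
  have h₂ := L.one_lt_abs_sub hkj
  have h₃ := h k
  grind

/-- A square sees another to its right through a horizontal strip missed by all squares lying
strictly between the two. -/
theorem exists_strip_of_seesFromLeft {i j : ι} (hij : i ≠ j) (h : SeesFromLeft L.square i j) :
    (L.pos i).1 + 1 < (L.pos j).1 ∧ ∃ c d : ℝ, c < d ∧
      ((L.pos i).2 ≤ c ∧ d ≤ (L.pos i).2 + 1) ∧ ((L.pos j).2 ≤ c ∧ d ≤ (L.pos j).2 + 1) ∧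
      ∀ k, (L.pos i).1 + 1 < (L.pos k).1 → (L.pos k).1 + 1 < (L.pos j).1 →
        d < (L.pos k).2 ∨ (L.pos k).2 + 1 < c := by
  obtain ⟨a, b, c, d, hab, hcd, hi, hj, h⟩ := h
  have hi' := (singleton_prod_Icc_subset_unitSquare_iff (p := L.pos i) hcd.le).1 hi
  have hj' := (singleton_prod_Icc_subset_unitSquare_iff (p := L.pos j) hcd.le).1 hj
  have hij' := L.one_lt_abs_sub hij
  refine ⟨by grind, c, d, hcd, hi'.2, hj'.2, fun k hk₁ hk₂ => ?_⟩
  have hk := (disjoint_rectangle_unitSquare_iff (p := L.pos k) hab.le hcd.le).1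
    (h k (by rintro rfl; linarith) (by rintro rfl; linarith))
  grind

/-- The reflection of a layout in the diagonal of the plane. -/
def swap : UnitSquareLayout ι where
  pos i := (L.pos i).swap
  disjoint _ _ hij := disjoint_unitSquare_iff.2 (L.one_lt_abs_sub hij).symm

theorem seesFromAbove_iff_swap (i j : ι) :
    SeesFromAbove L.square i j ↔ SeesFromLeft L.swap.square j i :=
  seesFromAbove_iff_seesFromLeft_swap L.pos i j

/-- One of the squares with indices `i` and `j` sees the other horizontally. -/
def SeesHorizontally (i j : ι) : Prop :=
  SeesFromLeft L.square i j ∨ SeesFromLeft L.square j i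

theorem graph_adj_iff {i j : ι} :
    L.graph.Adj i j ↔ i ≠ j ∧ (L.SeesHorizontally i j ∨ L.swap.SeesHorizontally i j) := by
  simp only [graph, SeesHorizontally, seesFromAbove_iff_swap]
  tauto

theorem graph_swap : L.swap.graph = L.graph := by
  ext i j
  rw [graph_adj_iff, graph_adj_iff, or_comm]
  rfl

end UnitSquareLayout

/-! ### Acyclic layouts have no vertex of degree seven -/

/-- In an acyclic graph, distinct neighbours of a vertex are not joined by a walk avoiding it. -/
theorem SimpleGraph.IsAcyclic.mem_support_of_adj_adj {V : Type*} {G : SimpleGraph V}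
    (hG : G.IsAcyclic) {u v w : V} (huw : u ≠ w) (hu : G.Adj v u) (hw : G.Adj v w)
    (q : G.Walk u w) : v ∈ q.support := by
  classical
  have hp : (SimpleGraph.Walk.cons hu.symm (.cons hw .nil)).IsPath := by
    simp [hu.ne', hw.ne, huw]
  have h := congrArg (fun r : G.Path u w => (r : G.Walk u w).support)
    ((hG.subsingleton_path u w).elim ⟨_, hp⟩ q.toPath)
  refine q.support_bypass_subset_support ?_
  change v ∈ (q.toPath : G.Walk u w).support
  rw [← h]
  simp

namespace UnitSquareLayout

variable {ι : Type*} (L : UnitSquareLayout ι)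

/-- Two squares both crossed by a horizontal strip are joined by a walk through squares that the
strip meets between them: if they do not see each other within the strip, then some square between
them meets the strip, and the walk is found by passing to narrower strips. -/
theorem exists_walk_in_strip [Finite ι] {i j : ι} {c d : ℝ} (hx : (L.pos i).1 < (L.pos j).1)
    (hcd : c < d) (hi : (L.pos i).2 ≤ c ∧ d ≤ (L.pos i).2 + 1)
    (hj : (L.pos j).2 ≤ c ∧ d ≤ (L.pos j).2 + 1) :
    ∃ q : L.graph.Walk i j, ∀ k ∈ q.support,
      (L.pos i).1 ≤ (L.pos k).1 ∧ (L.pos k).1 ≤ (L.pos j).1 ∧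
        (L.pos k).2 < d ∧ c < (L.pos k).2 + 1 := by
  let between (i j : ι) (c d : ℝ) : Set ι := {k | (L.pos i).1 < (L.pos k).1 ∧
    (L.pos k).1 < (L.pos j).1 ∧ (L.pos k).2 < d ∧ c < (L.pos k).2 + 1}
  induction hn : (between i j c d).ncard using Nat.strong_induction_on generalizing i j c d with
  | _ n ih =>
    subst hn
    by_cases hB : (between i j c d).Nonempty
    · obtain ⟨k, hk⟩ := hB
      obtain ⟨hik, hkj, hkd, hck⟩ := hk
      obtain ⟨c', d', hcd', hc, hkc, hd, hkd'⟩ : ∃ c' d' : ℝ, c' < d' ∧ c ≤ c' ∧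
          (L.pos k).2 ≤ c' ∧ d' ≤ d ∧ d' ≤ (L.pos k).2 + 1 :=
        ⟨max c (L.pos k).2, min d ((L.pos k).2 + 1),
          max_lt (lt_min hcd hck) (lt_min hkd (by linarith)),
          le_max_left _ _, le_max_right _ _, min_le_left _ _, min_le_right _ _⟩
      have hsub₁ : between i k c' d' ⊂ between i j c d :=
        ⟨fun l hl => ⟨hl.1, hl.2.1.trans hkj, hl.2.2.1.trans_le hd, hc.trans_lt hl.2.2.2⟩,
          fun h => (h ⟨hik, hkj, hkd, hck⟩).2.1.false⟩
      have hsub₂ : between k j c' d' ⊂ between i j c d :=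
        ⟨fun l hl => ⟨hik.trans hl.1, hl.2.1, hl.2.2.1.trans_le hd, hc.trans_lt hl.2.2.2⟩,
          fun h => (h ⟨hik, hkj, hkd, hck⟩).1.false⟩
      obtain ⟨q₁, h₁⟩ := ih _ (Set.ncard_lt_ncard hsub₁) hik hcd'
        ⟨hi.1.trans hc, hd.trans hi.2⟩ ⟨hkc, hkd'⟩ rfl
      obtain ⟨q₂, h₂⟩ := ih _ (Set.ncard_lt_ncard hsub₂) hkj hcd' ⟨hkc, hkd'⟩
        ⟨hj.1.trans hc, hd.trans hj.2⟩ rfl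
      refine ⟨q₁.append q₂, fun l hl => ?_⟩
      rcases (SimpleGraph.Walk.mem_support_append_iff _ _).1 hl with hl | hl
      · obtain ⟨h₃, h₄, h₅, h₆⟩ := h₁ l hl
        exact ⟨h₃, h₄.trans hkj.le, h₅.trans_le hd, hc.trans_lt h₆⟩
      · obtain ⟨h₃, h₄, h₅, h₆⟩ := h₂ l hl
        exact ⟨hik.le.trans h₃, h₄, h₅.trans_le hd, hc.trans_lt h₆⟩
    · have hij : i ≠ j := by rintro rfl; exact hx.false
      have hx' : (L.pos i).1 + 1 < (L.pos j).1 := by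
        have := L.one_lt_abs_sub hij
        clear ih
        grind
      -- The strip is narrowed so that squares merely touching its boundary become irrelevant.
      have hadj : L.graph.Adj i j := L.graph_adj_iff.2 ⟨hij, .inl (.inl
        (L.seesFromLeft_of_strip (c := c + (d - c) / 3) (d := d - (d - c) / 3) hx'
          (by linarith) (by constructor <;> linarith) (by constructor <;> linarith)
          fun k h₁ h₂ => by
            by_contra hk
            push Not at hk
            exact hB ⟨k, h₁, h₂, by linarith, by linarith⟩))⟩
      refine ⟨.cons hadj .nil, fun k hk => ?_⟩
      simp only [SimpleGraph.Walk.support_cons, SimpleGraph.Walk.support_nil, List.mem_cons,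
        List.not_mem_nil, or_false] at hk
      rcases hk with rfl | rfl <;> refine ⟨?_, ?_, ?_, ?_⟩ <;> linarith

variable {L}

/-- Distinct neighbours of `v` cannot both be crossed by a horizontal strip that does not meet the
square of `v` between them, since otherwise they lie on a cycle through `v`. -/
theorem meets_strip_of_isAcyclic [Finite ι] (hL : L.graph.IsAcyclic) {v u w : ι} (huw : u ≠ w)
    (hu : L.graph.Adj v u) (hw : L.graph.Adj v w) {c d : ℝ} (hcd : c < d)
    (hcu : (L.pos u).2 ≤ c ∧ d ≤ (L.pos u).2 + 1) (hcw : (L.pos w).2 ≤ c ∧ d ≤ (L.pos w).2 + 1) :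
    ((L.pos v).1 < (L.pos u).1 → (L.pos w).1 ≤ (L.pos v).1) ∧
    ((L.pos u).1 < (L.pos v).1 → (L.pos v).1 ≤ (L.pos w).1) ∧
    (L.pos v).2 < d ∧ c < (L.pos v).2 + 1 := by
  wlog hx : (L.pos u).1 < (L.pos w).1 generalizing u w
  · have hne : (L.pos w).1 < (L.pos u).1 := by
      have := L.one_lt_abs_sub huw
      grind
    have h := this huw.symm hw hu hcw hcu hne
    exact ⟨fun h₁ => not_lt.1 fun h₂ => (h.1 h₂).not_gt h₁,
      fun h₁ => not_lt.1 fun h₂ => (h.2.1 h₂).not_gt h₁, h.2.2⟩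
  obtain ⟨q, hq⟩ := L.exists_walk_in_strip hx hcd hcu hcw
  have hv := hq v (hL.mem_support_of_adj_adj huw hu hw q)
  exact ⟨fun h => absurd h hv.1.not_gt, fun _ => hv.2.1, hv.2.2⟩

theorem SeesHorizontally.abs_sub_lt {u v : ι} (huv : u ≠ v) (h : L.SeesHorizontally u v) :
    |(L.pos u).2 - (L.pos v).2| < 1 ∧ 1 < |(L.pos u).1 - (L.pos v).1| := by
  rcases h with h | h
  · obtain ⟨hx, c, d, h₁, h₂, h₃, -⟩ := L.exists_strip_of_seesFromLeft huv h
    grind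
  · obtain ⟨hx, c, d, h₁, h₂, h₃, -⟩ := L.exists_strip_of_seesFromLeft huv.symm h
    grind

/-- In an acyclic layout, a square has at most three squares in horizontal view. -/
theorem card_filter_seesHorizontally_le [Finite ι] (hL : L.graph.IsAcyclic) (v : ι) (s : Finset ι)
    (hs : ∀ u ∈ s, v ≠ u ∧ L.SeesHorizontally v u) : s.card ≤ 3 := by
  classical
  have hadj : ∀ u ∈ s, L.graph.Adj v u := fun u hu =>
    L.graph_adj_iff.2 ⟨(hs u hu).1, .inl (hs u hu).2⟩
  have habs : ∀ u ∈ s, |(L.pos v).2 - (L.pos u).2| < 1 ∧ 1 < |(L.pos v).1 - (L.pos u).1| :=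
    fun u hu => (hs u hu).2.abs_sub_lt (hs u hu).1
  -- Neighbours on the same side of `v` have offsets that differ by at least one.
  have hside : ∀ u ∈ s, ∀ w ∈ s, u ≠ w → |(L.pos u).2 - (L.pos w).2| < 1 →
      ((L.pos v).1 < (L.pos u).1 → (L.pos w).1 ≤ (L.pos v).1) ∧
      ((L.pos u).1 < (L.pos v).1 → (L.pos v).1 ≤ (L.pos w).1) := by
    intro u hu w hw huw h
    have := meets_strip_of_isAcyclic hL huw (hadj u hu) (hadj w hw)
      (c := max (L.pos u).2 (L.pos w).2) (d := min (L.pos u).2 (L.pos w).2 + 1)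
      (by grind) (by grind) (by grind)
    exact ⟨this.1, this.2.1⟩
  -- Two neighbours lying strictly higher than `v` are crossed by a strip above `v`.
  have hup : ∀ u ∈ s, ∀ w ∈ s, u ≠ w → (L.pos v).2 < (L.pos u).2 → ¬ (L.pos v).2 < (L.pos w).2 := by
    intro u hu w hw huw h₁ h₂
    have h₃ := habs u hu
    have h₄ := habs w hw
    have := meets_strip_of_isAcyclic hL huw (hadj u hu) (hadj w hw)
      (c := (L.pos v).2 + 1) (d := min (L.pos u).2 (L.pos w).2 + 1)
      (by grind) (by grind) (by grind)
    exact this.2.2.2.false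
  have hdown : ∀ u ∈ s, ∀ w ∈ s, u ≠ w → (L.pos u).2 < (L.pos v).2 →
      ¬ (L.pos w).2 < (L.pos v).2 := by
    intro u hu w hw huw h₁ h₂
    have h₃ := habs u hu
    have h₄ := habs w hw
    have := meets_strip_of_isAcyclic hL huw (hadj u hu) (hadj w hw)
      (c := max (L.pos u).2 (L.pos w).2) (d := (L.pos v).2)
      (by grind) (by grind) (by grind)
    exact this.2.2.1.false
  -- Hence there is at most one neighbour above `v`, below `v`, level with `v` on the left, and
  -- level with `v` on the right; the classes cannot all be inhabited.
  let f : ι → Fin 4 := fun u =>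
    if (L.pos v).2 < (L.pos u).2 then 0 else if (L.pos u).2 < (L.pos v).2 then 1 else
      if (L.pos v).1 < (L.pos u).1 then 2 else 3
  have hf : Set.InjOn f s := by
    intro u hu w hw hfuw
    by_contra huw
    have h₁ := hside u hu w hw huw
    have h₂ := hup u hu w hw huw
    have h₃ := hdown u hu w hw huw
    have h₄ := habs u hu
    have h₅ := habs w hw
    simp only [f] at hfuw
    grind
  by_contra hcard
  have hsurj : Set.SurjOn f s (Finset.univ : Finset (Fin 4)) :=
    Finset.surjOn_of_injOn_of_card_le f (fun _ _ => Finset.mem_univ _) hf (by simpa [Nat.lt_iff_add_one_le] using hcard)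
  obtain ⟨u₀, hu₀, h₀⟩ := hsurj (Finset.mem_coe.2 (Finset.mem_univ 0))
  obtain ⟨u₂, hu₂, h₂⟩ := hsurj (Finset.mem_coe.2 (Finset.mem_univ 2))
  obtain ⟨u₃, hu₃, h₃⟩ := hsurj (Finset.mem_coe.2 (Finset.mem_univ 3))
  have h₀₂ := hside u₀ hu₀ u₂ hu₂ (by rintro rfl; simp [h₀] at h₂)
  have h₀₃ := hside u₀ hu₀ u₃ hu₃ (by rintro rfl; simp [h₀] at h₃)
  have a₀ := habs u₀ hu₀
  have a₂ := habs u₂ hu₂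
  have a₃ := habs u₃ hu₃
  simp only [f] at h₀ h₂ h₃
  grind

theorem degree_le_six_of_isAcyclic [Finite ι] (hL : L.graph.IsAcyclic) (v : ι)
    [Fintype (L.graph.neighborSet v)] : L.graph.degree v ≤ 6 := by
  classical
  have hL' : L.swap.graph.IsAcyclic := by rwa [graph_swap]
  have hsub : L.graph.neighborFinset v ⊆
      {u ∈ L.graph.neighborFinset v | L.SeesHorizontally v u} ∪
        {u ∈ L.graph.neighborFinset v | L.swap.SeesHorizontally v u} := by
    intro u hu
    have := (L.graph_adj_iff.1 ((L.graph.mem_neighborFinset v u).1 hu)).2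
    simp only [Finset.mem_union, Finset.mem_filter]
    tauto
  have h₁ := card_filter_seesHorizontally_le hL v
    {u ∈ L.graph.neighborFinset v | L.SeesHorizontally v u} (fun u hu => by
      rw [Finset.mem_filter, SimpleGraph.mem_neighborFinset] at hu
      exact ⟨hu.1.ne, hu.2⟩)
  have h₂ := card_filter_seesHorizontally_le hL' v
    {u ∈ L.graph.neighborFinset v | L.swap.SeesHorizontally v u} (fun u hu => by
      rw [Finset.mem_filter, SimpleGraph.mem_neighborFinset] at hu
      exact ⟨hu.1.ne, hu.2⟩)
  calc L.graph.degree v = (L.graph.neighborFinset v).card := rfl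
    _ ≤ _ := Finset.card_le_card hsub
    _ ≤ _ := Finset.card_union_le _ _
    _ ≤ 6 := by omega

end UnitSquareLayout

/-! ### Families of horizontal spiders -/

/-- The height of the three legs of a horizontal spider above its centre. The leg `0` is level with
the centre. The legs `1` and `2` touch the same horizontal line from its two sides, so that their
squares do not see each other. -/
noncomputable def legOffset : Fin 3 → ℝ := ![0, 1 / 2, -1 / 2]

@[simp] theorem legOffset_zero : legOffset 0 = 0 := rfl

theorem abs_legOffset_le (r : Fin 3) : |legOffset r| ≤ 1 / 2 := by
  fin_cases r <;> norm_num [legOffset, abs_le]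

theorem abs_legOffset_sub_legOffset {r s : Fin 3} (hrs : r ≠ s) (hr : r ≠ 0) (hs : s ≠ 0) :
    |legOffset r - legOffset s| = 1 := by
  fin_cases r <;> fin_cases s <;> simp_all [legOffset] <;> norm_num

/-- The squares with lower left corners `p v` form horizontal spiders: each of the vertices
satisfying `OnLeg` lies on one of three legs of the spider centred at the square of another vertex,
which is not on a leg; the leg is `leg v` and `par v` is the preceding vertex on it, or the centre.
Leg `0` extends to the left and legs `1` and `2` to the right. The vertices are ordered by `idx`,
and each vertex on a leg lies further out than all earlier vertices of the whole family. Different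
spiders occupy disjoint ranges of heights. -/
structure IsSpiderFamily {V : Type*} (p : V → ℝ × ℝ) (idx : V → ℕ) (par center : V → V)
    (leg : V → Fin 3) (OnLeg : V → Prop) : Prop where
  idx_injective : Function.Injective idx
  idx_center_lt {w : V} : OnLeg w → idx (center w) < idx w
  idx_par_lt {w : V} : OnLeg w → idx (par w) < idx w
  not_onLeg_center {w : V} : OnLeg w → ¬ OnLeg (center w)
  par_eq_center_or {w : V} : OnLeg w →
    par w = center w ∨ (OnLeg (par w) ∧ center (par w) = center w ∧ leg (par w) = leg w)
  eq_of_par_eq {u w : V} : OnLeg u → OnLeg w → par u = par w → center u = center w →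
    leg u = leg w → u = w
  four_le_abs_sub {u w : V} : ¬ OnLeg u → ¬ OnLeg w → u ≠ w → 4 ≤ |(p u).2 - (p w).2|
  height {w : V} : OnLeg w → (p w).2 = (p (center w)).2 + legOffset (leg w)
  left {u w : V} : OnLeg w → leg w = 0 → idx u < idx w → (p w).1 + 1 < (p u).1
  right {u w : V} : OnLeg w → leg w ≠ 0 → idx u < idx w → (p u).1 + 1 < (p w).1

namespace IsSpiderFamily

variable {V : Type*} {p : V → ℝ × ℝ} {idx : V → ℕ} {par center : V → V} {leg : V → Fin 3}
  {OnLeg : V → Prop}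

/-- Two squares whose heights are close belong to the same spider. -/
theorem onLeg_of_abs_sub_lt (h : IsSpiderFamily p idx par center leg OnLeg) {u w : V}
    (huw : idx u < idx w) (hy : |(p u).2 - (p w).2| < 3) :
    OnLeg w ∧ ((¬ OnLeg u ∧ center w = u) ∨ (OnLeg u ∧ center u = center w)) := by
  have hne : u ≠ w := by rintro rfl; exact huw.false
  by_cases hu : OnLeg u <;> by_cases hw : OnLeg w
  · refine ⟨hw, .inr ⟨hu, by_contra fun hc => ?_⟩⟩
    have h₁ := h.four_le_abs_sub (h.not_onLeg_center hu) (h.not_onLeg_center hw) hc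
    have h₂ := h.height hu
    have h₃ := h.height hw
    have h₄ := abs_legOffset_le (leg u)
    have h₅ := abs_legOffset_le (leg w)
    clear h
    grind
  · have hc : center u ≠ w := by
      rintro rfl
      exact huw.asymm (h.idx_center_lt hu)
    have h₁ := h.four_le_abs_sub (h.not_onLeg_center hu) hw hc
    have h₂ := h.height hu
    have h₄ := abs_legOffset_le (leg u)
    clear h
    grind
  · refine ⟨hw, .inl ⟨hu, by_contra fun hc => ?_⟩⟩
    have h₁ := h.four_le_abs_sub (h.not_onLeg_center hw) hu hc
    have h₂ := h.height hw
    have h₄ := abs_legOffset_le (leg w)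
    clear h
    grind
  · have h₁ := h.four_le_abs_sub hu hw hne
    linarith

theorem one_lt_abs_sub (h : IsSpiderFamily p idx par center leg OnLeg) {u w : V} (huw : u ≠ w) :
    1 < |(p u).1 - (p w).1| ∨ 1 < |(p u).2 - (p w).2| := by
  wlog hlt : idx u < idx w generalizing u w
  · rw [abs_sub_comm, abs_sub_comm (p u).2]
    exact this huw.symm ((h.idx_injective.ne huw).symm.lt_of_le (not_lt.1 hlt))
  refine or_iff_not_imp_right.2 fun hy => ?_
  obtain ⟨hw, -⟩ := h.onLeg_of_abs_sub_lt hlt (by linarith)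
  by_cases h₀ : leg w = 0
  · have := h.left hw h₀ hlt
    exact lt_abs.2 (.inl (by linarith))
  · have := h.right hw h₀ hlt
    exact lt_abs.2 (.inr (by linarith))

/-- On a leg, `par w` is the last vertex before `w`. -/
theorem idx_le_idx_par (h : IsSpiderFamily p idx par center leg OnLeg) {u w : V} (hu : OnLeg u)
    (hw : OnLeg w) (hc : center u = center w) (hl : leg u = leg w) (huw : idx u < idx w) :
    OnLeg (par w) ∧ center (par w) = center w ∧ leg (par w) = leg w ∧ idx u ≤ idx (par w) := by
  induction hn : idx u using Nat.strong_induction_on generalizing u w with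
  | _ n ih =>
    subst hn
    by_contra hcon
    -- In this case `par w` comes before `u`, whether it is the centre or on the leg.
    have hlt : idx (par w) < idx u := by
      rcases h.par_eq_center_or hw with hpw | ⟨h₁, h₂, h₃⟩
      · rw [hpw, ← hc]
        exact h.idx_center_lt hu
      · exact not_le.1 fun hle => hcon ⟨h₁, h₂, h₃, hle⟩
    have hne : idx (par u) ≠ idx (par w) := fun he =>
      huw.ne (congrArg idx (h.eq_of_par_eq hu hw (h.idx_injective he) hc hl))
    rcases hne.lt_or_gt with hlt' | hlt'
    · rcases h.par_eq_center_or hw with hpw | ⟨h₁, h₂, h₃⟩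
      · rcases h.par_eq_center_or hu with hpu | ⟨h₄, h₅, h₆⟩
        · rw [hpw, hpu, hc] at hne
          exact hne rfl
        · have := h.idx_center_lt h₄
          rw [h₅, hc, ← hpw] at this
          omega
      · have := ih _ hlt h₁ hu (h₂.trans hc.symm) (h₃.trans hl.symm) hlt rfl
        omega
    · rcases h.par_eq_center_or hu with hpu | ⟨h₄, h₅, h₆⟩
      · rcases h.par_eq_center_or hw with hpw | ⟨h₁, h₂, h₃⟩
        · rw [hpw, hpu, hc] at hne
          exact hne rfl
        · have := h.idx_center_lt h₁
          rw [h₂, ← hc, ← hpu] at this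
          omega
      · have := ih _ (h.idx_par_lt hu) h₄ hw (h₅.trans hc) (h₆.trans hl)
          ((h.idx_par_lt hu).trans huw) rfl
        omega

variable {L : UnitSquareLayout V}

/-- A vertex on a leg and the vertex preceding it see each other: a blocking square would belong to
the same spider and come between the two on the same leg. -/
theorem seesHorizontally_par (h : IsSpiderFamily L.pos idx par center leg OnLeg) {w : V}
    (hw : OnLeg w) : L.SeesHorizontally (par w) w := by
  have hlt := h.idx_par_lt hw
  have hoff := abs_legOffset_le (leg w)
  have hyw := h.height hw
  have hy : |(L.pos (par w)).2 - (L.pos w).2| ≤ 1 / 2 := by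
    rcases h.par_eq_center_or hw with hp | ⟨hp, hpc, hpl⟩
    · rw [hp, hyw]
      clear h
      grind
    · rw [h.height hp, hyw, hpc, hpl]
      simp
  -- The interior of the common range of heights is free of blocking squares.
  obtain ⟨c, d, hcd, hu₁, hu₂, hw₁, hw₂⟩ : ∃ c d : ℝ, c < d ∧ (L.pos (par w)).2 < c ∧
      d < (L.pos (par w)).2 + 1 ∧ (L.pos w).2 < c ∧ d < (L.pos w).2 + 1 := by
    refine ⟨max (L.pos (par w)).2 (L.pos w).2 + 1 / 8,
      min (L.pos (par w)).2 (L.pos w).2 + 7 / 8, ?_⟩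
    clear h
    grind
  have hblock : ∀ k,
      ((L.pos (par w)).1 < (L.pos k).1 ∧ (L.pos k).1 < (L.pos w).1 ∨
        (L.pos w).1 < (L.pos k).1 ∧ (L.pos k).1 < (L.pos (par w)).1) →
      d < (L.pos k).2 ∨ (L.pos k).2 + 1 < c := by
    intro k hk
    by_contra! hcon
    have hkw : k ≠ w := by rintro rfl; simp at hk
    have hkp : k ≠ par w := by rintro rfl; simp at hk
    have hykw : |(L.pos k).2 - (L.pos w).2| < 1 := abs_lt.2 ⟨by linarith, by linarith⟩
    have hykp : |(L.pos k).2 - (L.pos (par w)).2| < 1 := abs_lt.2 ⟨by linarith, by linarith⟩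
    have hwk : idx k < idx w := by
      refine ((h.idx_injective.ne hkw).lt_or_gt).resolve_right fun hlt' => ?_
      obtain ⟨hD, -⟩ := h.onLeg_of_abs_sub_lt hlt' (by rw [abs_sub_comm]; linarith)
      by_cases h₀ : leg k = 0
      · have h₁ := h.left hD h₀ hlt'
        have h₂ := h.left hD h₀ (hlt.trans hlt')
        rcases hk with hk | hk <;> linarith [hk.1, hk.2]
      · have h₁ := h.right hD h₀ hlt'
        have h₂ := h.right hD h₀ (hlt.trans hlt')
        rcases hk with hk | hk <;> linarith [hk.1, hk.2]
    have hpk : idx (par w) < idx k := by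
      refine ((h.idx_injective.ne hkp).lt_or_gt).resolve_left fun hlt' => ?_
      obtain ⟨hD, -⟩ := h.onLeg_of_abs_sub_lt hlt' (by linarith)
      rcases h.par_eq_center_or hw with hp | ⟨hp, hpc, hpl⟩
      · exact h.not_onLeg_center hw (hp ▸ hD)
      by_cases h₀ : leg w = 0
      · have h₁ := h.left hw h₀ hlt
        have h₂ := h.left hp (hpl.trans h₀) hlt'
        rcases hk with hk | hk <;> linarith [hk.1, hk.2]
      · have h₁ := h.right hw h₀ hlt
        have h₂ := h.right hp (hpl.trans_ne h₀) hlt'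
        rcases hk with hk | hk <;> linarith [hk.1, hk.2]
    obtain ⟨hk', -⟩ := h.onLeg_of_abs_sub_lt hpk (by rw [abs_sub_comm]; linarith)
    have hck : center k = center w := by
      obtain ⟨-, hc | hc⟩ := h.onLeg_of_abs_sub_lt hwk (by linarith)
      · exact absurd hk' hc.1
      · exact hc.2
    by_cases hl : leg k = leg w
    · have := (h.idx_le_idx_par hk' hw hck hl hwk).2.2.2
      omega
    by_cases h₀ : leg w = 0
    · have h₁ := h.left hw h₀ hlt
      have h₂ := h.right hk' (fun h₃ => hl (h₃.trans h₀.symm)) hpk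
      rcases hk with hk | hk <;> linarith [hk.1, hk.2]
    by_cases h₀' : leg k = 0
    · have h₁ := h.right hw h₀ hlt
      have h₂ := h.left hk' h₀' hpk
      rcases hk with hk | hk <;> linarith [hk.1, hk.2]
    · have h₁ := abs_legOffset_sub_legOffset hl h₀' h₀
      rw [h.height hk', hyw, hck, add_sub_add_left_eq_sub, h₁] at hykw
      exact hykw.false
  by_cases h₀ : leg w = 0
  · exact .inr (L.seesFromLeft_of_strip (h.left hw h₀ hlt) hcd ⟨hw₁.le, hw₂.le⟩ ⟨hu₁.le, hu₂.le⟩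
      fun k h₁ h₂ => hblock k (.inr ⟨h₁, h₂⟩))
  · exact .inl (L.seesFromLeft_of_strip (h.right hw h₀ hlt) hcd ⟨hu₁.le, hu₂.le⟩ ⟨hw₁.le, hw₂.le⟩
      fun k h₁ h₂ => hblock k (.inl ⟨h₁, h₂⟩))

/-- In a spider family, a vertex sees no earlier vertex horizontally except its predecessor on its
leg: an intermediate square of the leg, or the centre, blocks every other view. -/
theorem par_eq_of_seesHorizontally (h : IsSpiderFamily L.pos idx par center leg OnLeg) {u w : V}
    (huw : idx u < idx w) (hs : L.SeesHorizontally u w) : OnLeg w ∧ par w = u := by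
  have hne : u ≠ w := by rintro rfl; exact huw.false
  obtain ⟨c, d, hcd, hu, hw, hk⟩ : ∃ c d : ℝ, c < d ∧
      ((L.pos u).2 ≤ c ∧ d ≤ (L.pos u).2 + 1) ∧ ((L.pos w).2 ≤ c ∧ d ≤ (L.pos w).2 + 1) ∧
      ∀ k, ((L.pos u).1 + 1 < (L.pos k).1 ∧ (L.pos k).1 + 1 < (L.pos w).1 ∨
        (L.pos w).1 + 1 < (L.pos k).1 ∧ (L.pos k).1 + 1 < (L.pos u).1) →
        d < (L.pos k).2 ∨ (L.pos k).2 + 1 < c := by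
    rcases hs with hs | hs
    · obtain ⟨hx, c, d, hcd, hu, hw, hk⟩ := L.exists_strip_of_seesFromLeft hne hs
      refine ⟨c, d, hcd, hu, hw, fun k h' => h'.elim (fun h' => hk k h'.1 h'.2) fun h' => ?_⟩
      linarith [h'.1, h'.2]
    · obtain ⟨hx, c, d, hcd, hw, hu, hk⟩ := L.exists_strip_of_seesFromLeft hne.symm hs
      refine ⟨c, d, hcd, hu, hw, fun k h' => h'.elim (fun h' => ?_) fun h' => hk k h'.1 h'.2⟩
      linarith [h'.1, h'.2]
  -- A square between the two which is level with one of them blocks the view.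
  have hblock : ∀ k, ((L.pos u).1 + 1 < (L.pos k).1 ∧ (L.pos k).1 + 1 < (L.pos w).1 ∨
        (L.pos w).1 + 1 < (L.pos k).1 ∧ (L.pos k).1 + 1 < (L.pos u).1) →
      (L.pos k).2 ≠ (L.pos u).2 ∧ (L.pos k).2 ≠ (L.pos w).2 := by
    intro k hk'
    have := hk k hk'
    constructor <;> intro he <;> rw [he] at this <;> rcases this with h' | h' <;>
      linarith [hu.1, hu.2, hw.1, hw.2]
  have hy : |(L.pos u).2 - (L.pos w).2| < 1 :=
    abs_lt.2 ⟨by linarith [hu.1, hw.2], by linarith [hw.1, hu.2]⟩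
  obtain ⟨hDw, hc⟩ := h.onLeg_of_abs_sub_lt huw (by linarith)
  refine ⟨hDw, by_contra fun hpar => ?_⟩
  have hlt := h.idx_par_lt hDw
  -- If `par w` is on the leg of `w` and comes after `u`, then it blocks the view.
  have hno : OnLeg (par w) → center (par w) = center w → leg (par w) = leg w →
      ¬ idx u < idx (par w) := by
    intro h₁ h₂ h₃ h₄
    refine (hblock (par w) ?_).2 (by rw [h.height h₁, h.height hDw, h₂, h₃])
    by_cases h₀ : leg w = 0
    · exact .inr ⟨h.left hDw h₀ hlt, h.left h₁ (h₃.trans h₀) h₄⟩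
    · exact .inl ⟨h.right h₁ (h₃.trans_ne h₀) h₄, h.right hDw h₀ hlt⟩
  rcases hc with ⟨-, hc⟩ | ⟨hDu, hc⟩
  · rcases h.par_eq_center_or hDw with hp | ⟨h₁, h₂, h₃⟩
    · exact hpar (hp.trans hc)
    · refine hno h₁ h₂ h₃ ?_
      have := h.idx_center_lt h₁
      rwa [h₂, hc] at this
  by_cases hl : leg u = leg w
  · obtain ⟨h₁, h₂, h₃, h₄⟩ := h.idx_le_idx_par hDu hDw hc hl huw
    exact hno h₁ h₂ h₃ (h₄.lt_of_ne fun he => hpar (h.idx_injective he).symm)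
  have hcu := h.idx_center_lt hDu
  have hcw := h.idx_center_lt hDw
  by_cases h₀ : leg w = 0
  · -- The centre of the spider separates leg `0` from the other two legs.
    refine (hblock (center w) (.inr ⟨h.left hDw h₀ hcw, ?_⟩)).2 ?_
    · rw [← hc]
      exact h.right hDu (fun h₁ => hl (h₁.trans h₀.symm)) hcu
    · rw [h.height hDw, h₀, legOffset_zero, add_zero]
  by_cases h₀' : leg u = 0
  · refine (hblock (center u) (.inl ⟨h.left hDu h₀' hcu, ?_⟩)).1 ?_
    · rw [hc]
      exact h.right hDw h₀ hcw
    · rw [h.height hDu, h₀', legOffset_zero, add_zero]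
  · rw [h.height hDu, h.height hDw, hc, add_sub_add_left_eq_sub,
      abs_legOffset_sub_legOffset hl h₀' h₀] at hy
    exact hy.false

end IsSpiderFamily

/-! ### Layouts of labelled rooted trees -/

/-- A rooted tree on `V`, encoded by its parent function (`par root` carries no information) and an
enumeration along which parents come first, whose edges from a vertex to its children carry distinct
labels in `Option (Fin 3)`. A child labelled `none` continues the leg of a spider on which its
parent lies; a child labelled `some s` starts leg `s` of the spider centred at its parent. -/
structure LabelledRootedTree (V : Type*) where
  /-- the root -/
  root : V
  /-- the parent of a vertex other than the root -/
  par : V → V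
  /-- the position of a vertex in the enumeration -/
  idx : V → ℕ
  /-- the label of the edge from a vertex to its parent -/
  label : V → Option (Fin 3)
  idx_injective : Function.Injective idx
  idx_par_lt {w : V} : w ≠ root → idx (par w) < idx w
  eq_of_label_eq {u w : V} : u ≠ root → w ≠ root → par u = par w → label u = label w → u = w

namespace LabelledRootedTree

variable {V : Type*} (t : LabelledRootedTree V)

open Classical in
/-- The leg on which a vertex lies: whether it is horizontal, the centre of its spider, and its
number. The root is treated as the end of a vertical leg of its own, centred at itself. -/
noncomputable def legData (w : V) : Bool × V × Fin 3 :=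
  if h : w = t.root then (false, t.root, 0)
  else
    have := t.idx_par_lt h
    match t.label w with
    | none => legData (t.par w)
    | some s => (!(legData (t.par w)).1, t.par w, s)
termination_by t.idx w

theorem legData_root : t.legData t.root = (false, t.root, 0) := by
  rw [legData]
  simp

variable {t}

theorem legData_of_label_none {w : V} (hw : w ≠ t.root) (hl : t.label w = none) :
    t.legData w = t.legData (t.par w) := by
  rw [legData]
  simp [hw, hl]

theorem legData_of_label_some {w : V} {s : Fin 3} (hw : w ≠ t.root) (hl : t.label w = some s) :
    t.legData w = (!(t.legData (t.par w)).1, t.par w, s) := by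
  rw [legData]
  simp [hw, hl]

variable (t)

/-- Whether a vertex lies on a horizontal leg. -/
noncomputable def isHorizontal (w : V) : Bool := (t.legData w).1

/-- The centre of the spider on a leg of which a vertex lies. -/
noncomputable def center (w : V) : V := (t.legData w).2.1

/-- The number of the leg on which a vertex lies. -/
noncomputable def leg (w : V) : Fin 3 := (t.legData w).2.2

/-- The coordinate of a vertex along its leg. Its absolute value grows along the enumeration and its
sign is the direction of the leg, so that vertices on a leg lie further and further out. -/
noncomputable def key (w : V) : ℝ := if t.leg w = 0 then -(4 * t.idx w) else 4 * t.idx w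

/-- The first (`b = true`) or second (`b = false`) coordinate of the square of a vertex. The
coordinate along the leg is the key of the vertex; the other one is that of the spider. -/
noncomputable def coord (b : Bool) (w : V) : ℝ :=
  if t.isHorizontal w = b then t.key w else t.key (t.center w) + legOffset (t.leg w)

variable {t}

theorem idx_center_lt {w : V} (hw : w ≠ t.root) : t.idx (t.center w) < t.idx w := by
  induction hn : t.idx w using Nat.strong_induction_on generalizing w with
  | _ n ih =>
    subst hn
    have hlt := t.idx_par_lt hw
    cases hl : t.label w with
    | none =>
      rw [center, legData_of_label_none hw hl]
      by_cases hp : t.par w = t.root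
      · rwa [hp, legData_root, ← hp]
      · exact (ih _ hlt hp rfl).trans hlt
    | some s => rwa [center, legData_of_label_some hw hl]

theorem idx_center_le (w : V) : t.idx (t.center w) ≤ t.idx w := by
  by_cases hw : w = t.root
  · rw [hw, center, legData_root]
  · exact (idx_center_lt hw).le

theorem isHorizontal_center {w : V} (hw : w ≠ t.root) (hc : t.center w ≠ t.root) :
    t.isHorizontal (t.center w) = !t.isHorizontal w := by
  induction hn : t.idx w using Nat.strong_induction_on generalizing w with
  | _ n ih =>
    subst hn
    cases hl : t.label w with
    | none =>
      have hcw : t.center w = t.center (t.par w) := by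
        rw [center, center, legData_of_label_none hw hl]
      have hhw : t.isHorizontal w = t.isHorizontal (t.par w) := by
        rw [isHorizontal, isHorizontal, legData_of_label_none hw hl]
      rw [hcw] at hc ⊢
      rw [hhw]
      refine ih _ (t.idx_par_lt hw) (fun hp => hc ?_) hc rfl
      rw [hp, center, legData_root]
    | some s => simp [center, isHorizontal, legData_of_label_some hw hl]

theorem abs_key (w : V) : |t.key w| = 4 * t.idx w := by
  unfold key
  split_ifs
  · rw [abs_neg, abs_of_nonneg (by positivity)]
  · rw [abs_of_nonneg (by positivity)]

theorem four_le_abs_key_sub_key {u w : V} (huw : u ≠ w) : 4 ≤ |t.key u - t.key w| := by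
  have hne := t.idx_injective.ne huw
  wlog hlt : t.idx u < t.idx w generalizing u w
  · rw [abs_sub_comm]
    exact this huw.symm hne.symm (hne.symm.lt_of_le (not_lt.1 hlt))
  have h : (t.idx u : ℝ) + 1 ≤ t.idx w := by exact_mod_cast hlt
  have h₁ := abs_sub_abs_le_abs_sub (t.key w) (t.key u)
  rw [abs_key, abs_key, abs_sub_comm] at h₁
  linarith

theorem abs_coord_le (b : Bool) (w : V) : |t.coord b w| ≤ 4 * t.idx w + 1 / 2 := by
  unfold coord
  split_ifs
  · rw [abs_key]
    linarith
  · have h : (t.idx (t.center w) : ℝ) ≤ t.idx w := by exact_mod_cast idx_center_le w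
    calc |t.key (t.center w) + legOffset (t.leg w)| ≤ _ := abs_add_le _ _
      _ ≤ _ := by rw [abs_key]; linarith [abs_legOffset_le (t.leg w)]

/-- A vertex not on a leg of orientation `b`, such as the centre of a spider of that orientation, is
placed at its key across the legs. At the root both coordinates are its key. -/
theorem coord_eq_key {b : Bool} {w : V} (hw : ¬ (t.isHorizontal w = b ∧ w ≠ t.root)) :
    t.coord (!b) w = t.key w := by
  by_cases hr : w = t.root
  · have hc : t.center w = w := by rw [hr, center, legData_root]
    have hl : t.leg w = 0 := by rw [hr, leg, legData_root]
    rw [coord, hc, hl, legOffset_zero, add_zero, ite_self]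
  · have hb : t.isHorizontal w = !b := by
      rw [Bool.eq_not]
      exact fun h => hw ⟨h, hr⟩
    rw [coord, if_pos hb]

/-- The horizontal legs form a family of horizontal spiders and, after reflection in the diagonal,
so do the vertical ones. -/
theorem isSpiderFamily (b : Bool) :
    IsSpiderFamily (fun w => (t.coord b w, t.coord (!b) w)) t.idx t.par t.center t.leg
      (fun w => t.isHorizontal w = b ∧ w ≠ t.root) where
  idx_injective := t.idx_injective
  idx_center_lt h := idx_center_lt h.2
  idx_par_lt h := t.idx_par_lt h.2
  not_onLeg_center := by
    rintro w ⟨hb, hw⟩ ⟨hcb, hc⟩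
    rw [isHorizontal_center hw hc, hb] at hcb
    exact Bool.not_ne_self b hcb
  par_eq_center_or := by
    rintro w ⟨hb, hw⟩
    cases hl : t.label w with
    | none =>
      have hd := legData_of_label_none hw hl
      by_cases hp : t.par w = t.root
      · left
        rw [center, hd, hp, legData_root]
      · right
        simp only [center, leg, isHorizontal, hd] at hb ⊢
        exact ⟨⟨hb, hp⟩, trivial, trivial⟩
    | some s =>
      left
      rw [center, legData_of_label_some hw hl]
  eq_of_par_eq := by
    rintro u w ⟨hbu, hu⟩ ⟨hbw, hw⟩ hp - hleg
    refine t.eq_of_label_eq hu hw hp ?_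
    cases hlu : t.label u <;> cases hlw : t.label w <;>
      simp_all [isHorizontal, leg, legData_of_label_none, legData_of_label_some]
  four_le_abs_sub := by
    intro u w hu hw huw
    rw [coord_eq_key hu, coord_eq_key hw]
    exact four_le_abs_key_sub_key huw
  height := by
    rintro w ⟨hb, hw⟩
    have hc : ¬ (t.isHorizontal (t.center w) = b ∧ t.center w ≠ t.root) := by
      rintro ⟨hcb, hc⟩
      rw [isHorizontal_center hw hc, hb] at hcb
      exact Bool.not_ne_self b hcb
    change t.coord (!b) w = t.coord (!b) (t.center w) + _
    rw [coord_eq_key hc, coord, if_neg (by simp [hb])]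
  left := by
    rintro u w ⟨hb, hw⟩ hl huw
    have h : (t.idx u : ℝ) + 1 ≤ t.idx w := by exact_mod_cast huw
    have h₁ := (abs_le.1 (t.abs_coord_le b u)).1
    have h₂ : t.coord b w = -(4 * t.idx w) := by rw [coord, if_pos hb, key, if_pos hl]
    change t.coord b w + 1 < t.coord b u
    linarith
  right := by
    rintro u w ⟨hb, hw⟩ hl huw
    have h : (t.idx u : ℝ) + 1 ≤ t.idx w := by exact_mod_cast huw
    have h₁ := (abs_le.1 (t.abs_coord_le b u)).2
    have h₂ : t.coord b w = 4 * t.idx w := by rw [coord, if_pos hb, key, if_neg hl]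
    change t.coord b u + 1 < t.coord b w
    linarith

variable (t)

/-- The unit square layout of a labelled rooted tree. -/
noncomputable def layout : UnitSquareLayout V where
  pos w := (t.coord true w, t.coord false w)
  disjoint _ _ huw := disjoint_unitSquare_iff.2 ((isSpiderFamily true).one_lt_abs_sub huw)

/-- The layout of a labelled rooted tree represents the tree. -/
theorem layout_graph_adj_iff {u w : V} : t.layout.graph.Adj u w ↔
    (w ≠ t.root ∧ t.par w = u) ∨ (u ≠ t.root ∧ t.par u = w) := by
  have hH : IsSpiderFamily t.layout.pos t.idx t.par t.center t.leg
    (fun w => t.isHorizontal w = true ∧ w ≠ t.root) := isSpiderFamily true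
  have hV : IsSpiderFamily t.layout.swap.pos t.idx t.par t.center t.leg
    (fun w => t.isHorizontal w = false ∧ w ≠ t.root) := isSpiderFamily false
  have hedge : ∀ w, w ≠ t.root → t.layout.graph.Adj (t.par w) w := by
    intro w hw
    refine t.layout.graph_adj_iff.2
      ⟨fun h => (t.idx_par_lt hw).ne (congrArg t.idx h), ?_⟩
    cases hb : t.isHorizontal w with
    | false => exact .inr (hV.seesHorizontally_par ⟨hb, hw⟩)
    | true => exact .inl (hH.seesHorizontally_par ⟨hb, hw⟩)
  constructor
  · intro h
    wlog hlt : t.idx u < t.idx w generalizing u w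
    · exact (this h.symm
        ((t.idx_injective.ne h.ne).symm.lt_of_le (not_lt.1 hlt))).symm
    left
    rcases (t.layout.graph_adj_iff.1 h).2 with hs | hs
    · obtain ⟨hw, hp⟩ := hH.par_eq_of_seesHorizontally hlt hs
      exact ⟨hw.2, hp⟩
    · obtain ⟨hw, hp⟩ := hV.par_eq_of_seesHorizontally hlt hs
      exact ⟨hw.2, hp⟩
  · rintro (⟨hw, rfl⟩ | ⟨hu, rfl⟩)
    · exact hedge w hw
    · exact (hedge u hu).symm

end LabelledRootedTree

/-! ### Trees of maximum degree at most five -/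

namespace SimpleGraph

variable {V : Type*} {T : SimpleGraph V}

/-- A rooting of a tree: `par w` is the second vertex of the path from `w` to the root `r`, and
`idx` enumerates the vertices with parents first. -/
theorem IsTree.exists_par_idx [Finite V] (hT : T.IsTree) (r : V) :
    ∃ (par : V → V) (idx : V → ℕ), Function.Injective idx ∧
      (∀ w, w ≠ r → T.Adj w (par w) ∧ idx (par w) < idx w) ∧
      ∀ u w, T.Adj u w → (w ≠ r ∧ par w = u) ∨ (u ≠ r ∧ par u = w) := by
  choose P hP _ using fun w => hT.existsUnique_path w r
  have hcons {u w : V} (h : T.Adj w u) (hw : w ∉ (P u).support) : P w = .cons h (P u) :=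
    congrArg Subtype.val ((hT.isAcyclic.subsingleton_path w r).elim ⟨_, hP w⟩
      ⟨_, (P u).cons_isPath_iff h |>.2 ⟨hP u, hw⟩⟩)
  have hlen {w : V} (q : T.Walk w r) (hq : q.IsPath) (hw : w ≠ r) :
      (P q.snd).length < q.length := by
    cases q with
    | nil => exact absurd rfl hw
    | @cons _ v _ h q =>
      have h₁ : P v = q := congrArg Subtype.val ((hT.isAcyclic.subsingleton_path v r).elim
        ⟨_, hP v⟩ ⟨_, hq.of_cons⟩)
      rw [Walk.snd_cons, h₁, Walk.length_cons]
      exact Nat.lt_succ_self _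
  obtain ⟨n, ⟨e⟩⟩ := Finite.exists_equiv_fin V
  -- Vertices are enumerated by their distance from the root.
  have hidx {u w : V} (h : (P u).length < (P w).length) :
      n * (P u).length + e u < n * (P w).length + e w := by
    have h₁ := Nat.mul_le_mul_left n (Nat.succ_le_of_lt h)
    rw [Nat.mul_succ] at h₁
    have h₂ := (e u).isLt
    omega
  refine ⟨fun w => (P w).snd, fun w => n * (P w).length + e w, fun u w h => ?_,
    fun w hw => ?_, fun u w h => ?_⟩
  · rcases lt_trichotomy (P u).length (P w).length with hl | hl | hl
    · exact absurd h (hidx hl).ne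
    · refine e.injective (Fin.ext ?_)
      simpa [hl] using h
    · exact absurd h (hidx hl).ne'
  · have hadj : T.Adj w (P w).snd := (P w).adj_snd (Walk.not_nil_of_ne hw)
    exact ⟨hadj, hidx (hlen _ (hP w) hw)⟩
  · by_cases hw : w ∈ (P u).support
    · refine .inr ⟨?_, (hT.isAcyclic.eq_snd_of_adj_start (hP u) h hw).symm⟩
      rintro rfl
      rw [(Walk.isPath_iff_nil.1 (hP u)).eq_nil, Walk.support_nil, List.mem_singleton] at hw
      exact h.ne' hw
    · refine .inl ⟨?_, by simp only [hcons h.symm hw, Walk.snd_cons]⟩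
      rintro rfl
      exact hw (P u).end_mem_support

/-- A tree of maximum degree at most five can be rooted, at a vertex of degree at most one, so that
no vertex has more children than there are labels. -/
theorem IsTree.exists_labelledRootedTree [Fintype V] [DecidableRel T.Adj] (hT : T.IsTree)
    (hdeg : T.maxDegree ≤ 5) : ∃ t : LabelledRootedTree V, ∀ u w, T.Adj u w ↔
      (w ≠ t.root ∧ t.par w = u) ∨ (u ≠ t.root ∧ t.par u = w) := by
  classical
  obtain ⟨r, hr⟩ : ∃ r, T.degree r ≤ 1 := by
    obtain ⟨v⟩ := hT.connected.nonempty
    rcases subsingleton_or_nontrivial V with hV | hV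
    · exact ⟨v, by rw [T.degree_eq_zero_of_subsingleton]; exact zero_le_one⟩
    · obtain ⟨r, hr⟩ := hT.exists_vert_degree_one_of_nontrivial
      exact ⟨r, hr.le⟩
  obtain ⟨par, idx, hinj, hpar, hadj⟩ := hT.exists_par_idx r
  have hchild (p : V) : ({w | w ≠ r ∧ par w = p} : Finset V).card ≤ 4 := by
    by_cases hp : p = r
    · refine (Finset.card_le_card (t := T.neighborFinset p) fun w hw => ?_).trans
        (by rw [card_neighborFinset_eq_degree, hp]; omega)
      simp only [Finset.mem_filter, Finset.mem_univ, true_and] at hw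
      rw [mem_neighborFinset, ← hw.2]
      exact (hpar w hw.1).1.symm
    · have hmem : par p ∈ T.neighborFinset p := by
        rw [mem_neighborFinset]
        exact (hpar p hp).1
      refine (Finset.card_le_card (t := (T.neighborFinset p).erase (par p)) fun w hw => ?_).trans ?_
      · simp only [Finset.mem_filter, Finset.mem_univ, true_and] at hw
        obtain ⟨hw, rfl⟩ := hw
        rw [Finset.mem_erase, mem_neighborFinset]
        refine ⟨fun h => ?_, (hpar w hw).1.symm⟩
        have h₁ := (hpar w hw).2
        have h₂ := (hpar _ hp).2
        rw [← h] at h₂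
        exact h₁.asymm h₂
      · rw [Finset.card_erase_of_mem hmem, card_neighborFinset_eq_degree]
        have := T.degree_le_maxDegree p
        omega
  have hlab (p : V) : ∃ f : V → Option (Fin 3), Set.InjOn f {w | w ≠ r ∧ par w = p} := by
    obtain ⟨g⟩ := Function.Embedding.nonempty_of_card_le
      (α := ({w | w ≠ r ∧ par w = p} : Finset V)) (β := Option (Fin 3))
      (by rw [Fintype.card_coe]; simpa using hchild p)
    refine ⟨fun w => if h : w ∈ ({w | w ≠ r ∧ par w = p} : Finset V) then g ⟨w, h⟩ else none,
      fun u hu w hw h => ?_⟩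
    have hu' : u ∈ ({w | w ≠ r ∧ par w = p} : Finset V) := by simpa using hu
    have hw' : w ∈ ({w | w ≠ r ∧ par w = p} : Finset V) := by simpa using hw
    simp only [hu', hw', dif_pos] at h
    exact congrArg Subtype.val (g.injective h)
  choose f hf using hlab
  refine ⟨⟨r, par, idx, fun w => f (par w) w, hinj, fun hw => (hpar _ hw).2,
    fun {u w} hu hw hp h => hf (par u) ⟨hu, rfl⟩ ⟨hw, hp.symm⟩ (by rwa [← hp] at h)⟩,
    fun u w => ⟨hadj u w, ?_⟩⟩
  rintro (⟨hw, rfl⟩ | ⟨hu, rfl⟩)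
  · exact (hpar w hw).1.symm
  · exact (hpar u hu).1

end SimpleGraph

theorem mainTheorem8 {V : Type*} [Fintype V] (T : SimpleGraph V) [DecidableRel T.Adj]
    (hT : T.IsTree) :
    (T.maxDegree ≤ 5 → IsUnitSquareVisibilityGraph T) ∧
      (7 ≤ T.maxDegree → ¬ IsUnitSquareVisibilityGraph T) := by
  refine ⟨fun hdeg => ?_, ?_⟩
  · obtain ⟨t, ht⟩ := hT.exists_labelledRootedTree hdeg
    refine ⟨inferInstance, t.layout, ?_⟩
    ext u w
    rw [t.layout_graph_adj_iff, ht]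
  · rintro hdeg ⟨-, L, rfl⟩
    have := hT.connected.nonempty
    obtain ⟨v, hv⟩ := L.graph.exists_maximal_degree_vertex
    have := UnitSquareLayout.degree_le_six_of_isAcyclic hT.isAcyclic v
    omega
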